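/- A cell of $\mathbb{Z}^2$ is a unit square with vertices in $\mathbb{Z}^2$. For a finite collection $\mathcal{S}$ of cells let $V(\mathcal{S})$ be the set of the vertices of its cells. For $a=(i,j)$ and $b=(k,l)$ in $\mathbb{Z}^2$ with $i<k$ and $j<l$, the interval $[a,b]$ is an inner interval of $\mathcal{S}$ if all cells contained in it belong to $\mathcal{S}$; its anti-diagonal corners are $c=(i,l)$ and $d=(k,j)$. For a field $K$ let $S_{\mathcal{S}}=K[x_v\mid v\in V(\mathcal{S})]$, let $I_{\mathcal{S}}$ be the ideal generated by all binomials $x_ax_b-x_cx_d$, where $[a,b]$ runs over the inner intervals of $\mathcal{S}$, let $K[\mathcal{S}]=S_{\mathcal{S}}/I_{\mathcal{S}}$ with the standard grading, and let $\mathrm{HP}_{K[\mathcal{S}]}(t)=\sum_{k\ge 0}\dim_K(K[\mathcal{S}]_k)\,t^k$. A finite collection of cells $\mathcal{P}$ is a closed path if its cells can be arranged in a sequence $C_1,\dots,C_n$, $n>5$, of distinct cells, indices being read modulo $n$, such that $C_i\cap C_{i+1}$ is a common edge of $C_i$ and $C_{i+1}$ for all $i$, and $V(C_i)\cap V(C_j)=\emptyset$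 whenever $j\notin\{i-2,i-1,i,i+1,i+2\}$. A configuration $\mathcal{W}$ consists of a horizontal block $[A_s,A_1]$ of $s\ge 2$ consecutive cells with rightmost cell $A_1$, a vertical block $[B_1,B_r]$ of $r\ge 2$ consecutive cells with lowest cell $B_1$, and a cell $A\notin[A_s,A_1]\cup[B_1,B_r]$, such that $V([A_s,A_1])\cap V([B_1,B_r])=\{b\}$, where $b$ is at the same time the lower right corner of $A$, the upper right corner of $A_1$ and the lower left corner of $B_1$ (so $A_1$ lies directly below $A$, and $B_1$ directly to the right of $A$). Proposition. Let $K$ be a field and let $\mathcal{P}$ be a closed path containing a configuration $\mathcal{W}$ as above. Put $\mathcal{Q}=\mathcal{P}\setminus\{A\}$ and $\mathcal{Q}_1=\mathcal{P}\setminus\{A,A_1,B_1\}$. Then $$\mathrm{HP}_{K[\mathcal{P}]}(t)=\mathrm{HP}_{K[\mathcal{Q}]}(t)+\frac{t}{1-t}\,\mathrm{HP}_{K[\mathcal{Q}_1]}(t).$$ -/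

import Mathlib

namespace Polyomino

/-- A cell of `ℤ²` is represented by its lower left corner. -/
abbrev Cell : Type := ℤ × ℤ

/-- A vertex is a point of `ℤ²`. -/
abbrev Vertex : Type := ℤ × ℤ

/-- The four corners of the cell with lower left corner `C`. -/
def cellVertices (C : Cell) : Finset Vertex :=
  {C, C + (1, 0), C + (0, 1), C + (1, 1)}

/-- The four edges of a cell, each given by its two endpoints. -/
def cellEdges (C : Cell) : Finset (Finset Vertex) :=
  {{C, C + (0, 1)}, {C + (0, 1), C + (1, 1)}, {C + (1, 1), C + (1, 0)}, {C, C + (1, 0)}}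

/-- The vertex set `V(P)` of a finite collection of cells. -/
def vertexSet (P : Finset Cell) : Finset Vertex :=
  P.biUnion cellVertices

/-- The interval `[a, b]` of `ℤ²` is a proper interval and all the cells it contains
belong to `P`. -/
def IsInnerInterval (P : Finset Cell) (a b : Vertex) : Prop :=
  a.1 < b.1 ∧ a.2 < b.2 ∧ ∀ C : Cell, a ≤ C → C + (1, 1) ≤ b → C ∈ P

/-- The polyomino ideal, generated by the inner 2-minors `x_a x_b - x_c x_d`, where `[a, b]` is
an inner interval with anti-diagonal corners `c` (upper left) and `d` (lower right). The corners
of an inner interval of `P` always lie in `V(P)`. -/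
noncomputable def polyominoIdeal (K : Type*) [Field K] (P : Finset Cell) :
    Ideal (MvPolynomial (vertexSet P) K) :=
  Ideal.span {f | ∃ a b c d : vertexSet P,
    IsInnerInterval P a b ∧
    (c : Vertex) = ((a : Vertex).1, (b : Vertex).2) ∧
    (d : Vertex) = ((b : Vertex).1, (a : Vertex).2) ∧
    f = MvPolynomial.X a * MvPolynomial.X b - MvPolynomial.X c * MvPolynomial.X d}

/-- The coordinate ring `K[P]`. -/
abbrev CoordinateRing (K : Type*) [Field K] (P : Finset Cell) : Type _ :=
  MvPolynomial (vertexSet P) K ⧸ polyominoIdeal K P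

/-- The graded component `K[P]_k`: the image of the forms of degree `k` in the quotient. -/
noncomputable def gradedPiece (K : Type*) [Field K] (P : Finset Cell) (k : ℕ) :
    Submodule K (CoordinateRing K P) :=
  (MvPolynomial.homogeneousSubmodule (vertexSet P) K k).map
    (Ideal.Quotient.mkₐ K (polyominoIdeal K P)).toLinearMap

/-- The Hilbert function `k ↦ dim_K K[P]_k`. -/
noncomputable def hilbertFunction (K : Type*) [Field K] (P : Finset Cell) (k : ℕ) : ℕ :=
  Module.finrank K (gradedPiece K P k)

/-- The Hilbert–Poincaré series of `K[P]`. -/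
noncomputable def hilbertSeries (K : Type*) [Field K] (P : Finset Cell) : PowerSeries ℚ :=
  PowerSeries.mk fun k => (hilbertFunction K P k : ℚ)

/-- `P` is a closed path: its cells form a cyclic sequence (indexed modulo `n`, with `n > 5`) of
distinct cells, consecutive ones sharing a common edge, and such that cells at cyclic distance
more than two have no common vertex. -/
def IsClosedPath (P : Finset Cell) : Prop :=
  ∃ n : ℕ, 5 < n ∧ ∃ A : ZMod n → Cell,
    (P : Set Cell) = Set.range A ∧
    (∀ i, cellVertices (A i) ∩ cellVertices (A (i + 1)) ∈
      cellEdges (A i) ∩ cellEdges (A (i + 1))) ∧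
    (∀ i j, i ≠ j → A i ≠ A j) ∧
    (∀ i j, j ∉ ({i - 2, i - 1, i, i + 1, i + 2} : Set (ZMod n)) →
      cellVertices (A i) ∩ cellVertices (A j) = ∅)

/-- The cell interval `[C, D]` is a horizontal block of `P` of rank at least two. -/
def IsHorizontalBlock (P : Finset Cell) (C D : Cell) : Prop :=
  C ≤ D ∧ C.2 = D.2 ∧ 2 ≤ (Finset.Icc C D).card ∧ Finset.Icc C D ⊆ P

/-- The cell interval `[C, D]` is a vertical block of `P` of rank at least two. -/
def IsVerticalBlock (P : Finset Cell) (C D : Cell) : Prop :=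
  C ≤ D ∧ C.1 = D.1 ∧ 2 ≤ (Finset.Icc C D).card ∧ Finset.Icc C D ⊆ P

/-- `P` contains a configuration `W`, made of a horizontal block `[As, A₁]` with rightmost cell
`A₁`, a vertical block `[B₁, Br]` with lowest cell `B₁`, and a further cell `A`. The two blocks meet
exactly in the lower right corner `b = A + (1, 0)` of `A`, which is the upper right corner of `A₁`
and the lower left corner of `B₁`. -/
structure IsConfigurationW (P : Finset Cell) (A As A₁ B₁ Br : Cell) : Prop where
  mem : A ∈ P
  horizontal : IsHorizontalBlock P As A₁
  vertical : IsVerticalBlock P B₁ Br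
  notMem : A ∉ Finset.Icc As A₁ ∪ Finset.Icc B₁ Br
  inter : vertexSet (Finset.Icc As A₁) ∩ vertexSet (Finset.Icc B₁ Br) = {A + (1, 0)}
  corner_A₁ : A₁ + (1, 1) = A + (1, 0)
  corner_B₁ : B₁ = A + (1, 0)

end Polyomino

/-!
Let `A` be the cell `(x, y)` at which the path turns, write `Q = P \ {A}` and let `Q₁` be `Q`
without the cells below and to the right of `A`. The only vertex of `P` that is not in `V(Q)` is
`(x, y + 1)`, and it is the upper left corner of exactly three inner intervals of `P`. Their lower
right corners are the vertices `v ∈ T` that are in `V(Q)` but not in `V(Q₁)`. With `u` for the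
variable of `(x, y + 1)` this gives `K[P] = K[Q][u] / (u x_v - q_v : v ∈ T)`, where `q_v` is the
product of the diagonal variables of the interval.

Modulo the relations of `K[Q]`, `x_v q_w = q_v x_w` for `v, w ∈ T`. Every minor of `Q` that
involves a `v ∈ T` is linear in the `x_v`, and replacing each `x_v` by `q_v` turns it into an
element of the ideal of `Q`; apart from these, the `x_v` have only the Koszul syzygies. Hence
`∑ a_v x_v = 0` implies `∑ a_v q_v = 0` in `K[Q]`. By comparing coefficients of powers of `u` it
follows that `K[Q]` embeds into `K[P]`, and that, for `f ∈ K[P]`, `u f ∈ K[Q]` if and only if `f`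
lies in the ideal `J = (x_v : v ∈ T)` of `K[Q]`. As `K[Q] / J = K[Q₁]`, and
`K[P]_{n+1} = K[Q]_{n+1} + u K[P]_n`, counting dimensions yields
`dim K[P]_{n+1} = dim K[Q]_{n+1} + dim K[P]_n - dim K[Q]_n + dim K[Q₁]_n`.
-/

namespace Polyomino

section LinearAlgebra

variable {K V W : Type*} [Field K] [AddCommGroup V] [Module K V] [AddCommGroup W] [Module K W]

theorem finrank_map_add_finrank_inf_ker (f : V →ₗ[K] W) (A : Submodule K V)
    [FiniteDimensional K A] :
    Module.finrank K (A.map f) + Module.finrank K ↥(A ⊓ LinearMap.ker f) = Module.finrank K A := by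
  rw [← LinearMap.finrank_range_add_finrank_ker (f.domRestrict A), LinearMap.range_domRestrict,
    LinearMap.ker_domRestrict, ← Submodule.finrank_map_subtype_eq, Submodule.map_comap_subtype]

theorem finrank_sup_map_add_finrank_inf_comap (f : V →ₗ[K] W) (A : Submodule K V)
    (B : Submodule K W) [FiniteDimensional K A] [FiniteDimensional K B] :
    Module.finrank K ↥(B ⊔ A.map f) + Module.finrank K ↥(A ⊓ B.comap f) =
      Module.finrank K B + Module.finrank K A := by
  have hAB := finrank_map_add_finrank_inf_ker f (A ⊓ B.comap f)
  rw [← Submodule.map_inf_eq_map_inf_comap, inf_assoc,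
    inf_eq_right.2 (LinearMap.ker_le_comap f)] at hAB
  have hsup := Submodule.finrank_sup_add_finrank_inf_eq B (A.map f)
  rw [inf_comm] at hsup
  have hA := finrank_map_add_finrank_inf_ker f A
  omega

end LinearAlgebra

theorem add_pow_succ_eq_pow_succ_add_mul {α : Type*} [IdemCommSemiring α] (a b : α) (n : ℕ) :
    (a + b) ^ (n + 1) = a ^ (n + 1) + b * (a + b) ^ n := by
  induction n with
  | zero => simp
  | succ n ih =>
    have absorb : a * (a + b) ^ n + (a + b) ^ (n + 1) = (a + b) ^ (n + 1) := by
      rw [pow_succ', add_mul, ← add_assoc, add_idem]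
    calc (a + b) ^ (n + 1 + 1) = a * (a + b) ^ (n + 1) + b * (a + b) ^ (n + 1) := by
          rw [pow_succ', add_mul]
      _ = a * (a ^ (n + 1) + b * (a + b) ^ n) + b * (a + b) ^ (n + 1) := by rw [ih]
      _ = a ^ (n + 1 + 1) + b * (a * (a + b) ^ n + (a + b) ^ (n + 1)) := by ring
      _ = a ^ (n + 1 + 1) + b * (a + b) ^ (n + 1) := by rw [absorb]

theorem span_insert_pow_succ {R A : Type*} [CommSemiring R] [CommSemiring A] [Algebra R A] (a : A)
    (s : Set A) (n : ℕ) : Submodule.span R (insert a s) ^ (n + 1) = Submodule.span R s ^ (n + 1) ⊔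
      (Submodule.span R (insert a s) ^ n).map (LinearMap.mulLeft R a) := by
  rw [Submodule.span_insert, sup_comm, ← Submodule.add_eq_sup, add_pow_succ_eq_pow_succ_add_mul,
    Submodule.add_eq_sup]
  congr 1
  ext b
  simp only [Submodule.mem_span_singleton_mul, Submodule.mem_map, LinearMap.mulLeft_apply]

theorem eq_add_X_mul_inv_one_sub_X_mul {F : Type*} [Field F] {f g h : PowerSeries F}
    (hzero : PowerSeries.coeff 0 f = PowerSeries.coeff 0 g)
    (hsucc : ∀ n, PowerSeries.coeff (n + 1) f + PowerSeries.coeff n g =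
      PowerSeries.coeff n f + PowerSeries.coeff (n + 1) g + PowerSeries.coeff n h) :
    f = g + PowerSeries.X * (1 - PowerSeries.X)⁻¹ * h := by
  have hfg : f - g = PowerSeries.X * (f - g + h) := by
    ext n
    cases n with
    | zero => rw [map_sub, hzero, sub_self, PowerSeries.coeff_zero_X_mul]
    | succ n =>
      rw [PowerSeries.coeff_succ_X_mul]
      simp only [map_sub, map_add]
      linear_combination hsucc n
  have hX : (1 - PowerSeries.X : PowerSeries F) * (1 - PowerSeries.X)⁻¹ = 1 :=
    PowerSeries.mul_inv_cancel _ (by simp)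
  linear_combination (1 - PowerSeries.X)⁻¹ * hfg - (f - g) * hX

theorem ker_le_of_comp_eq_mk {R A B : Type*} [CommSemiring R] [CommRing A] [CommRing B]
    [Algebra R A] [Algebra R B] {f : A →ₐ[R] B} {I : Ideal A} (g : B →ₐ[R] A ⧸ I)
    (h : g.comp f = Ideal.Quotient.mkₐ R I) : RingHom.ker f ≤ I := fun a ha => by
  rw [← Ideal.Quotient.eq_zero_iff_mem, ← Ideal.Quotient.mkₐ_eq_mk R, ← h, AlgHom.comp_apply,
    RingHom.mem_ker.1 ha, map_zero]

section PolynomialExtension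

open Polynomial

variable {R ι : Type*} [CommRing R] {p q : ι → R}

theorem coeff_zero_sum_mul_X_mul_C_sub_C [Fintype ι] (g : ι → R[X]) :
    (∑ i, g i * (X * C (p i) - C (q i))).coeff 0 = -∑ i, (g i).coeff 0 * q i := by
  simp [finsetSum_coeff, mul_sub, mul_comm X, ← mul_assoc]

theorem coeff_succ_sum_mul_X_mul_C_sub_C [Fintype ι] (g : ι → R[X]) (k : ℕ) :
    (∑ i, g i * (X * C (p i) - C (q i))).coeff (k + 1) =
      ∑ i, (g i).coeff k * p i - ∑ i, (g i).coeff (k + 1) * q i := by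
  simp [finsetSum_coeff, mul_sub, mul_comm X, ← mul_assoc]

theorem eq_zero_of_C_mem_span_X_mul_C_sub_C [Fintype ι]
    (hsyz : ∀ a : ι → R, ∑ i, a i * p i = 0 → ∑ i, a i * q i = 0) {r : R}
    (hr : C r ∈ Ideal.span (Set.range fun i => X * C (p i) - C (q i))) : r = 0 := by
  obtain ⟨g, hg⟩ := Ideal.mem_span_range_iff_exists_fun.1 hr
  have hzero : -∑ i, (g i).coeff 0 * q i = r := by
    rw [← coeff_zero_sum_mul_X_mul_C_sub_C, hg, coeff_C_zero]
  have hsucc (k : ℕ) : ∑ i, (g i).coeff k * p i = ∑ i, (g i).coeff (k + 1) * q i := by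
    rw [← sub_eq_zero, ← coeff_succ_sum_mul_X_mul_C_sub_C, hg, coeff_C_succ]
  obtain ⟨m, hm⟩ : ∃ m, ∀ i, (g i).natDegree < m := by
    obtain ⟨m, hm⟩ := (Set.finite_range fun i => (g i).natDegree).bddAbove
    exact ⟨m + 1, fun i => Nat.lt_succ_of_le (hm ⟨i, rfl⟩)⟩
  have htop : ∑ i, (g i).coeff m * q i = 0 :=
    Finset.sum_eq_zero fun i _ => by rw [coeff_eq_zero_of_natDegree_lt (hm i), zero_mul]
  have hbot : ∑ i, (g i).coeff 0 * q i = 0 :=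
    Nat.decreasingInduction (motive := fun k _ => ∑ i, (g i).coeff k * q i = 0)
      (fun k _ hk => hsyz _ ((hsucc k).trans hk)) htop m.zero_le
  rw [← hzero, hbot, neg_zero]

theorem exists_sub_C_mem_of_X_mul_sub_C_mem [Finite ι] {F : R[X]} {r : R}
    (h : X * F - C r ∈ Ideal.span (Set.range fun i => X * C (p i) - C (q i))) :
    ∃ a ∈ Ideal.span (Set.range p),
      F - C a ∈ Ideal.span (Set.range fun i => X * C (p i) - C (q i)) := by
  have := Fintype.ofFinite ι
  obtain ⟨g, hg⟩ := Ideal.mem_span_range_iff_exists_fun.1 h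
  have hcoeff (k : ℕ) :
      F.coeff k = ∑ i, (g i).coeff k * p i - ∑ i, (g i).coeff (k + 1) * q i := by
    rw [← coeff_succ_sum_mul_X_mul_C_sub_C, hg, coeff_sub, coeff_X_mul, coeff_C_succ, sub_zero]
  refine ⟨∑ i, (g i).coeff 0 * p i, Ideal.mem_span_range_iff_exists_fun.2 ⟨_, rfl⟩,
    Ideal.mem_span_range_iff_exists_fun.2 ⟨fun i => (g i).divX, ?_⟩⟩
  ext k
  cases k with
  | zero =>
    rw [coeff_zero_sum_mul_X_mul_C_sub_C, coeff_sub, coeff_C_zero, hcoeff]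
    simp only [coeff_divX]
    ring
  | succ k =>
    rw [coeff_succ_sum_mul_X_mul_C_sub_C, coeff_sub, coeff_C_succ, sub_zero, hcoeff]
    simp only [coeff_divX]

end PolynomialExtension

section Syzygies

open MvPolynomial

variable {σ R : Type*} [CommRing R]

/-- The module of all pairs `(∑ aᵥ Xᵥ, ∑ aᵥ qᵥ)`: the graph of the partial, multivalued map that
sends `Xᵥ` to `qᵥ` for `v ∈ s`. -/
noncomputable def substitutionGraph (s : Set σ) (q : σ → MvPolynomial σ R) :
    Submodule (MvPolynomial σ R) (MvPolynomial σ R × MvPolynomial σ R) :=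
  Submodule.span _ ((fun v => (X v, q v)) '' s)

section

variable {s : Set σ} {q : σ → MvPolynomial σ R}

theorem X_prodMk_mem_substitutionGraph {v : σ} (hv : v ∈ s) :
    (X v, q v) ∈ substitutionGraph s q :=
  Submodule.subset_span ⟨v, hv, rfl⟩

theorem mul_X_sub_mul_X_prodMk_mem_substitutionGraph {v w : σ} (hv : v ∈ s) (hw : w ∈ s)
    (f g : MvPolynomial σ R) :
    (f * X v - g * X w, f * q v - g * q w) ∈ substitutionGraph s q :=
  sub_mem (Submodule.smul_mem _ f (X_prodMk_mem_substitutionGraph hv))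
    (Submodule.smul_mem _ g (X_prodMk_mem_substitutionGraph hw))

theorem exists_mem_substitutionGraph_iff {f : MvPolynomial σ R} :
    (∃ z, (f, z) ∈ substitutionGraph s q) ↔ f ∈ Ideal.span (X '' s) := by
  have hmap : (substitutionGraph s q).map (LinearMap.fst _ _ _) = Ideal.span (X '' s) := by
    rw [substitutionGraph, Submodule.map_span, Set.image_image]
    rfl
  rw [← hmap]
  simp

theorem X_mul_sub_mul_mem_of_mem_substitutionGraph {I : Ideal (MvPolynomial σ R)} {b : σ}
    (hq : ∀ v ∈ s, X b * q v - q b * X v ∈ I) {f z : MvPolynomial σ R}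
    (hf : (f, z) ∈ substitutionGraph s q) : X b * z - q b * f ∈ I := by
  suffices h : ∀ p ∈ substitutionGraph s q, X b * p.2 - q b * p.1 ∈ I from h (f, z) hf
  intro p hp
  induction hp using Submodule.span_induction with
  | mem p hp =>
    obtain ⟨v, hv, rfl⟩ := hp
    exact hq v hv
  | zero => simp
  | add p p' _ _ hp hp' =>
    convert I.add_mem hp hp' using 1
    simp only [Prod.fst_add, Prod.snd_add]
    ring
  | smul r p _ hp =>
    convert I.mul_mem_left r hp using 1
    simp only [Prod.smul_fst, Prod.smul_snd, smul_eq_mul]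
    ring

theorem mem_span_X_image_of_mul_X_mem {b : σ} (hb : b ∉ s) {f : MvPolynomial σ R}
    (hf : f * X b ∈ Ideal.span (X '' s)) : f ∈ Ideal.span (X '' s) := by
  rw [mem_ideal_span_X_image] at hf ⊢
  intro m hm
  obtain ⟨v, hv, hmv⟩ := hf (m + Finsupp.single b 1) (by simpa [support_mul_X] using hm)
  refine ⟨v, hv, ?_⟩
  rwa [Finsupp.add_apply, Finsupp.single_eq_of_ne (by rintro rfl; exact hb hv), add_zero] at hmv

end

-- The syzygies of distinct variables are generated by the Koszul ones, `Xᵥ · X_w - X_w · Xᵥ = 0`;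
-- so the partial map `Xᵥ ↦ qᵥ` is well defined modulo `I` as soon as `I` contains their images.
theorem mem_of_zero_prodMk_mem_substitutionGraph (s : Finset σ) {q : σ → MvPolynomial σ R}
    {I : Ideal (MvPolynomial σ R)} (hq : ∀ v ∈ s, ∀ w ∈ s, X v * q w - q v * X w ∈ I)
    {z : MvPolynomial σ R} (hz : (0, z) ∈ substitutionGraph (s : Set σ) q) : z ∈ I := by
  classical
  induction s using Finset.induction_on generalizing z with
  | empty =>
    obtain rfl : z = 0 := by simpa [substitutionGraph] using hz
    exact I.zero_mem
  | insert b s hb ih =>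
    rw [substitutionGraph, Finset.coe_insert, Set.image_insert_eq, Submodule.mem_span_insert] at hz
    obtain ⟨c, ⟨f, f'⟩, hf, hzero⟩ := hz
    obtain ⟨hcf, rfl⟩ : 0 = c * X b + f ∧ z = c * q b + f' := Prod.ext_iff.1 hzero
    have hcX : c * X b ∈ Ideal.span (X '' (s : Set σ)) := by
      have hcf' : c * X b = -f := eq_neg_of_add_eq_zero_left hcf.symm
      rw [hcf']
      exact neg_mem (exists_mem_substitutionGraph_iff.1 ⟨f', hf⟩)
    obtain ⟨d, hd⟩ := exists_mem_substitutionGraph_iff.2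
      (mem_span_X_image_of_mul_X_mem (s := (s : Set σ)) (by simpa using hb) hcX)
    have hcd : X b * d - q b * c ∈ I := X_mul_sub_mul_mem_of_mem_substitutionGraph
      (fun v hv => hq b (Finset.mem_insert_self b s) v (Finset.mem_insert_of_mem hv)) hd
    have hdf : X b * d + f' ∈ I := by
      refine ih (fun v hv w hw => hq v (Finset.mem_insert_of_mem hv) w
        (Finset.mem_insert_of_mem hw)) ?_
      have hsum := add_mem (Submodule.smul_mem _ (X b) hd) hf
      rwa [Prod.smul_mk, Prod.mk_add_mk, smul_eq_mul, smul_eq_mul, mul_comm (X b) c, ← hcf] at hsum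
    convert I.sub_mem hdf hcd using 1
    ring

/-- The evaluation `Xᵥ ↦ 0` for `v ∈ s`. -/
noncomputable def killVariables (s : Set σ) : MvPolynomial σ R →ₐ[R] MvPolynomial σ R :=
  aeval (sᶜ.indicator X)

theorem killVariables_X_of_mem {s : Set σ} {v : σ} (hv : v ∈ s) :
    killVariables s (X v : MvPolynomial σ R) = 0 := by
  rw [killVariables, aeval_X, Set.indicator_of_notMem (Set.notMem_compl_iff.2 hv)]

theorem killVariables_X_of_notMem {s : Set σ} {v : σ} (hv : v ∉ s) :
    killVariables s (X v : MvPolynomial σ R) = X v := by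
  rw [killVariables, aeval_X, Set.indicator_of_mem (Set.mem_compl hv)]

theorem killVariables_eq_zero_of_mem_span {s : Set σ} {f : MvPolynomial σ R}
    (hf : f ∈ Ideal.span (X '' s)) : killVariables s f = 0 := by
  have hle : Ideal.span (X '' s) ≤ RingHom.ker (killVariables (R := R) s) := by
    rw [Ideal.span_le]
    rintro _ ⟨v, hv, rfl⟩
    exact killVariables_X_of_mem hv
  exact hle hf

theorem sub_killVariables_mem_span (s : Set σ) (f : MvPolynomial σ R) :
    f - killVariables s f ∈ Ideal.span (X '' s) := by
  have heq : (Ideal.Quotient.mkₐ R (Ideal.span (X '' s))).comp (killVariables s) =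
      Ideal.Quotient.mkₐ R (Ideal.span (X '' s)) := by
    ext v
    by_cases hv : v ∈ s
    · have hX : (X v : MvPolynomial σ R) ∈ Ideal.span (X '' s) := Ideal.subset_span ⟨v, hv, rfl⟩
      simpa [killVariables_X_of_mem hv] using (Ideal.Quotient.eq_zero_iff_mem.2 hX).symm
    · simp [killVariables_X_of_notMem hv]
  exact (Ideal.Quotient.mk_eq_mk_iff_sub_mem _ _).1 (AlgHom.congr_fun heq f).symm

theorem exists_mem_sub_killVariables_mem_substitutionGraph {s : Set σ}
    {q : σ → MvPolynomial σ R} {G : Set (MvPolynomial σ R)}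
    (hG : ∀ g ∈ G, killVariables s g = g ∨ ∃ z ∈ Ideal.span G, (g, z) ∈ substitutionGraph s q)
    {f : MvPolynomial σ R} (hf : f ∈ Ideal.span G) :
    ∃ z ∈ Ideal.span G, (f - killVariables s f, z) ∈ substitutionGraph s q := by
  induction hf using Submodule.span_induction with
  | mem g hg =>
    rcases hG g hg with hg | ⟨z, hz, hgz⟩
    · exact ⟨0, zero_mem _, by rw [hg, sub_self]; exact zero_mem _⟩
    · refine ⟨z, hz, ?_⟩
      rwa [killVariables_eq_zero_of_mem_span (exists_mem_substitutionGraph_iff.1 ⟨z, hgz⟩),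
        sub_zero]
  | zero => exact ⟨0, zero_mem _, by rw [map_zero, sub_zero]; exact zero_mem _⟩
  | add f g _ _ hf hg =>
    obtain ⟨z, hz, hfz⟩ := hf
    obtain ⟨w, hw, hgw⟩ := hg
    refine ⟨z + w, add_mem hz hw, ?_⟩
    convert add_mem hfz hgw using 1
    simp [add_sub_add_comm]
  | smul r f hf' hf =>
    obtain ⟨z, hz, hfz⟩ := hf
    obtain ⟨w, hw⟩ := exists_mem_substitutionGraph_iff (q := q).2 (sub_killVariables_mem_span s r)
    refine ⟨killVariables s r * z + f * w,
      add_mem (Ideal.mul_mem_left _ _ hz) (Ideal.mul_mem_right _ _ hf'), ?_⟩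
    convert add_mem (Submodule.smul_mem _ (killVariables s r) hfz) (Submodule.smul_mem _ f hw)
      using 1
    simp only [Prod.smul_mk, Prod.mk_add_mk, smul_eq_mul, map_mul, Prod.mk.injEq, and_true]
    ring

theorem sum_mul_mem_of_sum_mul_X_mem {s : Finset σ} {q : σ → MvPolynomial σ R}
    {G : Set (MvPolynomial σ R)}
    (hq : ∀ v ∈ s, ∀ w ∈ s, X v * q w - q v * X w ∈ Ideal.span G)
    (hG : ∀ g ∈ G, killVariables (s : Set σ) g = g ∨
      ∃ z ∈ Ideal.span G, (g, z) ∈ substitutionGraph (s : Set σ) q)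
    {a : s → MvPolynomial σ R} (ha : ∑ v, a v * X (v : σ) ∈ Ideal.span G) :
    ∑ v, a v * q v ∈ Ideal.span G := by
  have hsum : (∑ v, a v * X (v : σ), ∑ v, a v * q v) ∈ substitutionGraph (s : Set σ) q := by
    have heq : (∑ v, a v * X (v : σ), ∑ v, a v * q v) = ∑ v, a v • (X (v : σ), q v) :=
      Prod.ext (by simp [Prod.fst_sum]) (by simp [Prod.snd_sum])
    rw [heq]
    exact sum_mem fun v _ => Submodule.smul_mem _ _ (X_prodMk_mem_substitutionGraph v.2)
  obtain ⟨z, hz, hfz⟩ := exists_mem_sub_killVariables_mem_substitutionGraph hG ha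
  rw [killVariables_eq_zero_of_mem_span (exists_mem_substitutionGraph_iff.1 ⟨_, hsum⟩),
    sub_zero] at hfz
  have hdiff := mem_of_zero_prodMk_mem_substitutionGraph s hq
    (z := ∑ v, a v * q v - z) (by simpa using sub_mem hsum hfz)
  simpa using add_mem hdiff hz

end Syzygies

section CoordinateRing

variable {K : Type*} [Field K] {P : Finset Cell}

theorem mem_cellVertices {C : Cell} {v : Vertex} :
    v ∈ cellVertices C ↔ (v.1 = C.1 ∨ v.1 = C.1 + 1) ∧ (v.2 = C.2 ∨ v.2 = C.2 + 1) := by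
  obtain ⟨a, b⟩ := C
  obtain ⟨x, y⟩ := v
  simp only [cellVertices, Finset.mem_insert, Finset.mem_singleton, Prod.mk_add_mk, Prod.mk.injEq]
  omega

theorem mem_vertexSet {v : Vertex} : v ∈ vertexSet P ↔ ∃ C ∈ P, v ∈ cellVertices C := by
  simp [vertexSet]

theorem isInnerInterval_iff {a b : Vertex} : IsInnerInterval P a b ↔
    a.1 < b.1 ∧ a.2 < b.2 ∧
      ∀ i j, a.1 ≤ i → a.2 ≤ j → i + 1 ≤ b.1 → j + 1 ≤ b.2 → (i, j) ∈ P := by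
  refine and_congr_right fun _ => and_congr_right fun _ =>
    ⟨fun h i j h₁ h₂ h₃ h₄ => h _ ⟨h₁, h₂⟩ ⟨h₃, h₄⟩, fun h C h₁ h₂ => ?_⟩
  exact h C.1 C.2 h₁.1 h₁.2 h₂.1 h₂.2

theorem IsInnerInterval.not_le_of_notMem {a b : Vertex} (h : IsInnerInterval P a b) {i j : ℤ}
    (hij : (i, j) ∉ P) : ¬(a.1 ≤ i ∧ a.2 ≤ j ∧ i + 1 ≤ b.1 ∧ j + 1 ≤ b.2) :=
  fun hle => hij ((isInnerInterval_iff.1 h).2.2 i j hle.1 hle.2.1 hle.2.2.1 hle.2.2.2)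

theorem IsInnerInterval.mono {Q : Finset Cell} (h : P ⊆ Q) {a b : Vertex}
    (hab : IsInnerInterval P a b) : IsInnerInterval Q a b :=
  ⟨hab.1, hab.2.1, fun C h₁ h₂ => h (hab.2.2 C h₁ h₂)⟩

theorem IsInnerInterval.mem_vertexSet {a b : Vertex} (h : IsInnerInterval P a b) {v : Vertex}
    (h₁ : v.1 = a.1 ∨ v.1 = b.1) (h₂ : v.2 = a.2 ∨ v.2 = b.2) : v ∈ vertexSet P := by
  rw [isInnerInterval_iff] at h
  rw [Polyomino.mem_vertexSet]
  refine ⟨(if v.1 = a.1 then v.1 else v.1 - 1, if v.2 = a.2 then v.2 else v.2 - 1),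
    h.2.2 _ _ ?_ ?_ ?_ ?_, mem_cellVertices.2 ⟨?_, ?_⟩⟩ <;>
  · split_ifs <;> omega

/-- The assignment `v ↦ f v` satisfies the relations `x_a x_b = x_c x_d` of `K[P]`. -/
def RespectsMinors {S : Type*} [Mul S] (P : Finset Cell) (f : Vertex → S) : Prop :=
  ∀ a b, IsInnerInterval P a b → f a * f b = f (a.1, b.2) * f (b.1, a.2)

theorem RespectsMinors.mono {S : Type*} [Mul S] {Q : Finset Cell} (h : P ⊆ Q) {f : Vertex → S}
    (hf : RespectsMinors Q f) : RespectsMinors P f :=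
  fun a b hab => hf a b (hab.mono h)

namespace CoordinateRing

open MvPolynomial

variable (K P) in
/-- The class of `x_v` in `K[P]`, extended by `0` to the vertices outside `V(P)`. -/
noncomputable def var (v : Vertex) : CoordinateRing K P :=
  if h : v ∈ vertexSet P then Ideal.Quotient.mk _ (X ⟨v, h⟩) else 0

theorem var_coe (v : vertexSet P) : var K P v = Ideal.Quotient.mk _ (X v) :=
  dif_pos v.2

theorem var_of_notMem {v : Vertex} (hv : v ∉ vertexSet P) : var K P v = 0 :=
  dif_neg hv

theorem respectsMinors_var : RespectsMinors P (var K P) := by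
  intro a b hab
  have hmem (v : Vertex) (h₁ : v.1 = a.1 ∨ v.1 = b.1) (h₂ : v.2 = a.2 ∨ v.2 = b.2) :=
    hab.mem_vertexSet h₁ h₂
  lift a to vertexSet P using hmem a (by simp) (by simp)
  lift b to vertexSet P using hmem b (by simp) (by simp)
  obtain ⟨c, hc⟩ : ∃ c : vertexSet P, (c : Vertex) = ((a : Vertex).1, (b : Vertex).2) :=
    ⟨⟨_, hmem (_, _) (by simp) (by simp)⟩, rfl⟩
  obtain ⟨d, hd⟩ : ∃ d : vertexSet P, (d : Vertex) = ((b : Vertex).1, (a : Vertex).2) :=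
    ⟨⟨_, hmem (_, _) (by simp) (by simp)⟩, rfl⟩
  rw [← hc, ← hd, var_coe, var_coe, var_coe, var_coe, ← map_mul, ← map_mul]
  exact Ideal.Quotient.eq.2 (Ideal.subset_span ⟨a, b, c, d, hab, hc, hd, rfl⟩)

section Lift

variable {S : Type*} [CommRing S] [Algebra K S]

/-- The universal property of `K[P]`. -/
noncomputable def lift (f : Vertex → S) (hf : RespectsMinors P f) : CoordinateRing K P →ₐ[K] S :=
  Ideal.Quotient.liftₐ _ (aeval fun v => f v) <| by
    change polyominoIdeal K P ≤ RingHom.ker (aeval fun v : vertexSet P => f v)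
    rw [polyominoIdeal, Ideal.span_le]
    rintro _ ⟨a, b, c, d, hab, hc, hd, rfl⟩
    simpa [RingHom.mem_ker, sub_eq_zero, hc, hd] using hf a b hab

theorem lift_var {f : Vertex → S} {hf : RespectsMinors P f} {v : Vertex}
    (hv : v ∈ vertexSet P) : lift (K := K) f hf (var K P v) = f v := by
  lift v to vertexSet P using hv
  rw [var_coe]
  exact (Ideal.Quotient.lift_mk _ _ _).trans (aeval_X _ v)

theorem algHom_ext {S : Type*} [Semiring S] [Algebra K S] {f g : CoordinateRing K P →ₐ[K] S}
    (h : ∀ v ∈ vertexSet P, f (var K P v) = g (var K P v)) : f = g := by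
  refine Ideal.Quotient.algHom_ext _ (MvPolynomial.algHom_ext fun v => ?_)
  simpa [var_coe] using h v v.2

theorem surjective_of_var_mem_range {f : S →ₐ[K] CoordinateRing K P}
    (h : ∀ v ∈ vertexSet P, var K P v ∈ f.range) : Function.Surjective f := by
  intro g
  obtain ⟨g, rfl⟩ := Ideal.Quotient.mk_surjective g
  change Ideal.Quotient.mkₐ K (polyominoIdeal K P) g ∈ f.range
  induction g using MvPolynomial.induction_on with
  | C r => exact f.range.algebraMap_mem r
  | add p q hp hq => rw [map_add]; exact add_mem hp hq
  | mul_X p v hp =>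
    have hv := h v v.2
    rw [var_coe] at hv
    rw [map_mul]
    exact mul_mem hp hv

end Lift

variable (K P) in
/-- The defining relations of `K[P]` as a quotient of the polynomial ring on all vertices. -/
def relations : Set (MvPolynomial Vertex K) :=
  {f | ∃ a b, IsInnerInterval P a b ∧ f = X a * X b - X (a.1, b.2) * X (b.1, a.2)} ∪
    X '' {v | v ∉ vertexSet P}

theorem ker_aeval_var : RingHom.ker (aeval (R := K) (var K P)) = Ideal.span (relations K P) := by
  apply le_antisymm
  · let I := Ideal.span (relations K P)
    have hrel : RespectsMinors P fun v => Ideal.Quotient.mk I (X v) := by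
      intro a b hab
      dsimp only
      rw [← map_mul, ← map_mul]
      exact Ideal.Quotient.eq.2 (Ideal.subset_span (Or.inl ⟨a, b, hab, rfl⟩))
    refine ker_le_of_comp_eq_mk (lift _ hrel) (MvPolynomial.algHom_ext fun v => ?_)
    rw [AlgHom.comp_apply, aeval_X, Ideal.Quotient.mkₐ_eq_mk]
    by_cases hv : v ∈ vertexSet P
    · exact lift_var hv
    · rw [var_of_notMem hv, map_zero]
      exact (Ideal.Quotient.eq_zero_iff_mem.2 (Ideal.subset_span (Or.inr ⟨v, hv, rfl⟩)) :
        Ideal.Quotient.mk I (X v) = 0).symm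
  · rw [Ideal.span_le]
    rintro _ (⟨a, b, hab, rfl⟩ | ⟨v, hv, rfl⟩)
    · simpa [sub_eq_zero] using respectsMinors_var a b hab
    · simpa using var_of_notMem hv

theorem aeval_var_surjective : Function.Surjective (aeval (R := K) (var K P)) :=
  surjective_of_var_mem_range (f := aeval (R := K) (var K P)) fun v _ => ⟨X v, aeval_X _ v⟩

theorem image_var_eq : var K P '' vertexSet P = Ideal.Quotient.mkₐ K _ '' Set.range X := by
  rw [← Set.range_comp, Set.image_eq_range]
  exact congrArg Set.range (funext var_coe)

end CoordinateRing

open CoordinateRing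

theorem gradedPiece_eq_pow (n : ℕ) :
    gradedPiece K P n = Submodule.span K (var K P '' vertexSet P) ^ n := by
  rw [gradedPiece, ← MvPolynomial.homogeneousSubmodule_one_pow,
    MvPolynomial.homogeneousSubmodule_one_eq_span_X, Submodule.map_pow, Submodule.map_span,
    image_var_eq]
  rfl

instance (n : ℕ) : FiniteDimensional K (gradedPiece K P n) := by
  have := (MvPolynomial.homogeneousSubmodule_fg K (σ := vertexSet P) n)
  exact Module.Finite.iff_fg.2 (this.map _)

namespace CoordinateRing

open Polynomial

variable (K P) in
/-- The action of `𝔾ₘ` on `K[P]`: it multiplies a form of degree `n` by `X ^ n`, and so detects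
the grading. -/
noncomputable def scale : CoordinateRing K P →ₐ[K] (CoordinateRing K P)[X] :=
  lift (fun v => C (var K P v) * X) fun a b hab => by
    have := congrArg (C : CoordinateRing K P → _) (respectsMinors_var (K := K) a b hab)
    rw [C_mul, C_mul] at this
    linear_combination X ^ 2 * this

theorem scale_var (v : Vertex) : scale K P (var K P v) = C (var K P v) * X := by
  by_cases hv : v ∈ vertexSet P
  · exact lift_var hv
  · simp [var_of_notMem hv]

theorem scale_eq_of_mem_gradedPiece {n : ℕ} {f : CoordinateRing K P}
    (hf : f ∈ gradedPiece K P n) : scale K P f = C f * X ^ n := by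
  rw [gradedPiece_eq_pow] at hf
  have hlinear (g) (hg : g ∈ Submodule.span K (var K P '' vertexSet P)) :
      scale K P g = C g * X := by
    induction hg using Submodule.span_induction with
    | mem g hg =>
      obtain ⟨v, -, rfl⟩ := hg
      exact scale_var v
    | zero => simp
    | add g g' _ _ hg hg' => rw [map_add, hg, hg', C_add, add_mul]
    | smul r g _ hg => rw [map_smul, hg, ← smul_C, smul_mul_assoc]
  induction hf using Submodule.pow_induction_on_left' with
  | algebraMap r => simp [Polynomial.algebraMap_apply]
  | add f g n _ _ hf hg => rw [map_add, hf, hg, C_add, add_mul]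
  | mem_mul g hg n f _ hf => rw [map_mul, hlinear g hg, hf, C_mul, pow_succ]; ring

theorem exists_sum_eq (f : CoordinateRing K P) :
    ∃ (m : ℕ) (g : ℕ → CoordinateRing K P), (∀ n, g n ∈ gradedPiece K P n) ∧
      ∑ n ∈ Finset.range m, g n = f := by
  obtain ⟨f, rfl⟩ := Ideal.Quotient.mk_surjective f
  refine ⟨f.totalDegree + 1, fun n => Ideal.Quotient.mk _ (MvPolynomial.homogeneousComponent n f),
    fun n => ⟨_, MvPolynomial.homogeneousComponent_mem n f, rfl⟩, ?_⟩
  rw [← map_sum, MvPolynomial.sum_homogeneousComponent]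

theorem mem_gradedPiece_iff {n : ℕ} {f : CoordinateRing K P} :
    f ∈ gradedPiece K P n ↔ scale K P f = C f * X ^ n := by
  refine ⟨scale_eq_of_mem_gradedPiece, fun h => ?_⟩
  obtain ⟨m, g, hg, hgf⟩ := exists_sum_eq f
  have hcoeff : (∑ k ∈ Finset.range m, C (g k) * X ^ k).coeff n = f := by
    rw [← Finset.sum_congr rfl fun k _ => scale_eq_of_mem_gradedPiece (hg k), ← map_sum, hgf, h,
      coeff_C_mul_X_pow, if_pos rfl]
  rw [finsetSum_coeff] at hcoeff
  simp only [coeff_C_mul_X_pow, Finset.sum_ite_eq] at hcoeff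
  rw [← hcoeff]
  split_ifs
  · exact hg n
  · exact zero_mem _

end CoordinateRing

end CoordinateRing


section ClosedPath

/-- Two cells share an edge. -/
def Adjacent (C D : Cell) : Prop :=
  (C.1 - D.1).natAbs + (C.2 - D.2).natAbs = 1

theorem Adjacent.symm {C D : Cell} (h : Adjacent C D) : Adjacent D C := by
  simp only [Adjacent] at *
  omega

theorem adjacent_of_inter_mem_cellEdges {C D : Cell} (hne : C ≠ D)
    (h : cellVertices C ∩ cellVertices D ∈ cellEdges C) : Adjacent C D := by
  have hends (v w : Vertex) (hvw : cellVertices C ∩ cellVertices D = {v, w}) :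
      v ∈ cellVertices D ∧ w ∈ cellVertices D := by
    constructor <;> exact Finset.inter_subset_right (by rw [hvw]; simp)
  simp only [cellEdges, Finset.mem_insert, Finset.mem_singleton] at h
  rw [Ne, Prod.ext_iff] at hne
  rcases h with h | h | h | h <;>
  · have := hends _ _ h
    simp only [mem_cellVertices, Prod.fst_add, Prod.snd_add] at this
    simp only [Adjacent]
    omega

theorem cellVertices_inter_nonempty {C D : Cell} (h₁ : (C.1 - D.1).natAbs ≤ 1)
    (h₂ : (C.2 - D.2).natAbs ≤ 1) : (cellVertices C ∩ cellVertices D).Nonempty := by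
  refine ⟨(max C.1 D.1, max C.2 D.2), ?_⟩
  simp only [Finset.mem_inter, mem_cellVertices]
  omega

variable {P : Finset Cell}

namespace IsClosedPath

theorem exists_neighbors (hP : IsClosedPath P) {C : Cell} (hC : C ∈ P) :
    ∃ X ∈ P, ∃ Y ∈ P, Adjacent C X ∧ Adjacent C Y ∧
      ∀ D ∈ P, D ≠ C → (cellVertices C ∩ cellVertices D).Nonempty →
        D = X ∨ D = Y ∨ Adjacent X D ∨ Adjacent Y D := by
  obtain ⟨n, hn, A, hPA, hedge, hinj, hdisj⟩ := hP
  have : Fact (1 < n) := ⟨by omega⟩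
  have hmem (D : Cell) : D ∈ P ↔ ∃ i, A i = D := by rw [← Finset.mem_coe, hPA, Set.mem_range]
  have hsucc (i : ZMod n) : Adjacent (A i) (A (i + 1)) :=
    adjacent_of_inter_mem_cellEdges (hinj _ _ (by simp)) (Finset.mem_inter.1 (hedge i)).1
  have hpred (i : ZMod n) : Adjacent (A i) (A (i - 1)) := by simpa using (hsucc (i - 1)).symm
  obtain ⟨i, rfl⟩ := (hmem C).1 hC
  refine ⟨A (i - 1), (hmem _).2 ⟨_, rfl⟩, A (i + 1), (hmem _).2 ⟨_, rfl⟩, hpred i, hsucc i, ?_⟩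
  intro D hD hDi h
  obtain ⟨j, rfl⟩ := (hmem D).1 hD
  by_cases hj : j ∈ ({i - 2, i - 1, i, i + 1, i + 2} : Set (ZMod n))
  · rcases hj with rfl | rfl | rfl | rfl | rfl
    · have := hpred (i - 1)
      rw [sub_sub, one_add_one_eq_two] at this
      exact .inr (.inr (.inl this))
    · exact .inl rfl
    · exact absurd rfl hDi
    · exact .inr (.inl rfl)
    · have := hsucc (i + 1)
      rw [add_assoc, one_add_one_eq_two] at this
      exact .inr (.inr (.inr this))
  · rw [hdisj i j hj] at h
    exact absurd h Finset.not_nonempty_empty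

theorem notMem_of_adjacent (hP : IsClosedPath P) {C D E F : Cell} (hC : C ∈ P) (hD : D ∈ P)
    (hE : E ∈ P) (hCD : Adjacent C D) (hCE : Adjacent C E) (hDE : D ≠ E) (hCF : Adjacent C F)
    (hFD : F ≠ D) (hFE : F ≠ E) : F ∉ P := by
  obtain ⟨X, -, Y, -, hX, hY, hXY⟩ := hP.exists_neighbors hC
  have eq_or_eq (G : Cell) (hG : G ∈ P) (hCG : Adjacent C G) : G = X ∨ G = Y := by
    simp only [Adjacent, Prod.ext_iff] at *
    have hGC : G ≠ C := by rintro rfl; omega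
    have := hXY G hG hGC (cellVertices_inter_nonempty (by omega) (by omega))
    omega
  intro hF
  have := eq_or_eq D hD hCD
  have := eq_or_eq E hE hCE
  have := eq_or_eq F hF hCF
  grind

theorem notMem_of_diagonal (hP : IsClosedPath P) {i j k l : ℤ} (hij : (i, j) ∈ P)
    (hk : (k - i).natAbs = 1) (hl : (l - j).natAbs = 1) (hil : (i, l) ∉ P) (hkj : (k, j) ∉ P) :
    (k, l) ∉ P := by
  have key (C : Cell) (hC : C ∈ P) (hCij : Adjacent (i, j) C) :
      C ≠ (k, l) ∧ ¬Adjacent C (k, l) := by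
    have := ne_of_mem_of_not_mem hC hil
    have := ne_of_mem_of_not_mem hC hkj
    simp only [Adjacent, Ne, Prod.ext_iff] at *
    omega
  intro hkl
  obtain ⟨C, hC, D, hD, hCij, hDij, hCD⟩ := hP.exists_neighbors hij
  have := hCD _ hkl (by rw [Ne, Prod.mk.injEq]; omega)
    (cellVertices_inter_nonempty (by dsimp only; omega) (by dsimp only; omega))
  have := key C hC hCij
  have := key D hD hDij
  tauto

end IsClosedPath

/-- The cell `(x, y)` is a corner of `P`: the path `P` comes from the cell `(x - 1, y - 1)`, runs
through the cells below, at and to the right of `(x, y)`, and leaves through `(x + 1, y + 1)`. The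
excluded cells are those that could share with these three a vertex or an inner interval on which
the Hilbert series depends. -/
structure IsCorner (P : Finset Cell) (x y : ℤ) : Prop where
  mem : (x, y) ∈ P
  mem_below : (x, y - 1) ∈ P
  mem_right : (x + 1, y) ∈ P
  mem_below_left : (x - 1, y - 1) ∈ P
  mem_right_above : (x + 1, y + 1) ∈ P
  left : (x - 1, y) ∉ P
  above : (x, y + 1) ∉ P
  above_left : (x - 1, y + 1) ∉ P
  below_right : (x + 1, y - 1) ∉ P
  below_below : (x, y - 2) ∉ P
  below_below_right : (x + 1, y - 2) ∉ P
  right_right : (x + 2, y) ∉ P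
  right_right_below : (x + 2, y - 1) ∉ P

theorem IsClosedPath.isCorner (hP : IsClosedPath P) {x y : ℤ} (h : (x, y) ∈ P)
    (hbelow : (x, y - 1) ∈ P) (hright : (x + 1, y) ∈ P) (hbelow_left : (x - 1, y - 1) ∈ P)
    (hright_above : (x + 1, y + 1) ∈ P) : IsCorner P x y := by
  have left : (x - 1, y) ∉ P := by
    apply hP.notMem_of_adjacent h hbelow hright <;>
      simp only [Adjacent, Ne, Prod.mk.injEq] <;> omega
  have above : (x, y + 1) ∉ P := by
    apply hP.notMem_of_adjacent h hbelow hright <;>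
      simp only [Adjacent, Ne, Prod.mk.injEq] <;> omega
  have below_right : (x + 1, y - 1) ∉ P := by
    apply hP.notMem_of_adjacent hbelow h hbelow_left <;>
      simp only [Adjacent, Ne, Prod.mk.injEq] <;> omega
  have below_below : (x, y - 2) ∉ P := by
    apply hP.notMem_of_adjacent hbelow h hbelow_left <;>
      simp only [Adjacent, Ne, Prod.mk.injEq] <;> omega
  have right_right : (x + 2, y) ∉ P := by
    apply hP.notMem_of_adjacent hright h hright_above <;>
      simp only [Adjacent, Ne, Prod.mk.injEq] <;> omega
  exact
    { mem := h, mem_below := hbelow, mem_right := hright, mem_below_left := hbelow_left,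
      mem_right_above := hright_above, left, above, below_right, below_below, right_right
      above_left := hP.notMem_of_diagonal h (by omega) (by omega) above left
      below_below_right :=
        hP.notMem_of_diagonal hbelow (by omega) (by omega) below_below below_right
      right_right_below :=
        hP.notMem_of_diagonal hright (by omega) (by omega) below_right right_right }

theorem IsHorizontalBlock.sub_one_mem {C : Cell} {i j : ℤ} (h : IsHorizontalBlock P C (i, j)) :
    (i - 1, j) ∈ P := by
  obtain ⟨hle, hj, hcard, hsub⟩ := h
  obtain ⟨D, hD, hne⟩ := Finset.exists_mem_ne hcard (i, j)
  rw [Finset.mem_Icc] at hD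
  refine hsub (Finset.mem_Icc.2 ?_)
  simp only [Prod.le_def, Ne, Prod.ext_iff] at *
  omega

theorem IsVerticalBlock.add_one_mem {D : Cell} {i j : ℤ} (h : IsVerticalBlock P (i, j) D) :
    (i, j + 1) ∈ P := by
  obtain ⟨hle, hi, hcard, hsub⟩ := h
  obtain ⟨E, hE, hne⟩ := Finset.exists_mem_ne hcard (i, j)
  rw [Finset.mem_Icc] at hE
  refine hsub (Finset.mem_Icc.2 ?_)
  simp only [Prod.le_def, Ne, Prod.ext_iff] at *
  omega

theorem IsConfigurationW.isCorner {A As A₁ B₁ Br : Cell} (hW : IsConfigurationW P A As A₁ B₁ Br)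
    (hP : IsClosedPath P) : IsCorner P A.1 A.2 ∧ A₁ = (A.1, A.2 - 1) ∧ B₁ = (A.1 + 1, A.2) := by
  obtain ⟨x, y⟩ := A
  obtain rfl : A₁ = (x, y - 1) := by
    have := hW.corner_A₁
    simp only [Prod.ext_iff, Prod.fst_add, Prod.snd_add] at this ⊢
    omega
  obtain rfl : B₁ = (x + 1, y) := by simpa using hW.corner_B₁
  exact ⟨hP.isCorner hW.mem (hW.horizontal.2.2.2 (Finset.right_mem_Icc.2 hW.horizontal.1))
    (hW.vertical.2.2.2 (Finset.left_mem_Icc.2 hW.vertical.1)) hW.horizontal.sub_one_mem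
    hW.vertical.add_one_mem, rfl, rfl⟩

end ClosedPath

/-- The vertices of the two cells next to a corner `(x, y)` that disappear together with them:
they belong to no cell of `P` other than `(x, y)`, `(x, y - 1)` and `(x + 1, y)`. -/
def cornerVertices (x y : ℤ) : Finset Vertex :=
  {(x + 1, y), (x + 1, y - 1), (x + 2, y)}

theorem mem_cornerVertices {x y : ℤ} {v : Vertex} : v ∈ cornerVertices x y ↔
    (v.1 = x + 1 ∧ v.2 = y) ∨ (v.1 = x + 1 ∧ v.2 = y - 1) ∨ (v.1 = x + 2 ∧ v.2 = y) := by
  simp only [cornerVertices, Finset.mem_insert, Finset.mem_singleton, Prod.ext_iff]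

namespace IsCorner

variable {P : Finset Cell} {x y : ℤ}

theorem notMem_vertexSet (h : IsCorner P x y) : (x, y + 1) ∉ vertexSet (P \ {(x, y)}) := by
  rw [mem_vertexSet]
  rintro ⟨⟨i, j⟩, hC, hv⟩
  rw [Finset.mem_sdiff, Finset.mem_singleton] at hC
  have := ne_of_mem_of_not_mem hC.1 h.left
  have := ne_of_mem_of_not_mem hC.1 h.above
  have := ne_of_mem_of_not_mem hC.1 h.above_left
  simp only [mem_cellVertices, Ne, Prod.mk.injEq] at *
  omega

theorem vertexSet_eq (h : IsCorner P x y) :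
    vertexSet P = insert (x, y + 1) (vertexSet (P \ {(x, y)})) := by
  ext v
  simp only [Finset.mem_insert, mem_vertexSet, Finset.mem_sdiff, Finset.mem_singleton]
  constructor
  · rintro ⟨C, hC, hv⟩
    by_cases hCA : C = (x, y)
    · rw [hCA, mem_cellVertices] at hv
      have hcases : v = (x, y + 1) ∨ v.2 = y ∧ (v.1 = x ∨ v.1 = x + 1) ∨
          v.1 = x + 1 ∧ v.2 = y + 1 := by
        rw [Prod.ext_iff]
        dsimp only at *
        omega
      rcases hcases with hv | hv | hv
      · exact .inl hv
      · exact .inr ⟨_, ⟨h.mem_below, by simp⟩, mem_cellVertices.2 ⟨hv.2, .inr (by simp [hv.1])⟩⟩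
      · exact .inr ⟨_, ⟨h.mem_right, by simp⟩, mem_cellVertices.2 ⟨.inl hv.1, .inr hv.2⟩⟩
    · exact .inr ⟨C, ⟨hC, hCA⟩, hv⟩
  · rintro (rfl | ⟨C, hC, hv⟩)
    · exact ⟨_, h.mem, by simp [mem_cellVertices]⟩
    · exact ⟨C, hC.1, hv⟩

theorem notMem_vertexSet_of_mem_cornerVertices (h : IsCorner P x y) {v : Vertex}
    (hv : v ∈ cornerVertices x y) :
    v ∉ vertexSet (P \ {(x, y), (x, y - 1), (x + 1, y)}) := by
  rw [mem_vertexSet]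
  rintro ⟨⟨i, j⟩, hC, hvC⟩
  simp only [Finset.mem_sdiff, Finset.mem_insert, Finset.mem_singleton] at hC
  have := ne_of_mem_of_not_mem hC.1 h.below_right
  have := ne_of_mem_of_not_mem hC.1 h.below_below
  have := ne_of_mem_of_not_mem hC.1 h.below_below_right
  have := ne_of_mem_of_not_mem hC.1 h.right_right
  have := ne_of_mem_of_not_mem hC.1 h.right_right_below
  simp only [mem_cellVertices, mem_cornerVertices, Ne, Prod.mk.injEq] at *
  omega

theorem mem_vertexSet_of_notMem_cornerVertices (h : IsCorner P x y) {v : Vertex}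
    (hv : v ∈ vertexSet (P \ {(x, y)})) (hvT : v ∉ cornerVertices x y) :
    v ∈ vertexSet (P \ {(x, y), (x, y - 1), (x + 1, y)}) := by
  simp only [mem_vertexSet, Finset.mem_sdiff, Finset.mem_insert, Finset.mem_singleton] at hv ⊢
  obtain ⟨C, hC, hvC⟩ := hv
  rw [mem_cornerVertices] at hvT
  by_cases hbelow : C = (x, y - 1)
  · rw [hbelow, mem_cellVertices] at hvC
    exact ⟨_, ⟨h.mem_below_left, by simp⟩, mem_cellVertices.2 (by dsimp only at *; omega)⟩
  by_cases hright : C = (x + 1, y)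
  · rw [hright, mem_cellVertices] at hvC
    exact ⟨_, ⟨h.mem_right_above, by simp⟩, mem_cellVertices.2 (by dsimp only at *; omega)⟩
  exact ⟨C, ⟨hC.1, by tauto⟩, hvC⟩

theorem isInnerInterval_cases (h : IsCorner P x y) {a b : Vertex} (hab : IsInnerInterval P a b) :
    IsInnerInterval (P \ {(x, y)}) a b ∨
      ∃ v ∈ cornerVertices x y, a = (x, v.2) ∧ b = (v.1, y + 1) := by
  obtain ⟨h₁, h₂, hmem⟩ := isInnerInterval_iff.1 hab
  by_cases hA : a.1 ≤ x ∧ a.2 ≤ y ∧ x + 1 ≤ b.1 ∧ y + 1 ≤ b.2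
  · have := hab.not_le_of_notMem h.left
    have := hab.not_le_of_notMem h.above
    have := hab.not_le_of_notMem h.below_right
    have := hab.not_le_of_notMem h.below_below
    have := hab.not_le_of_notMem h.right_right
    refine .inr ⟨(b.1, a.2), mem_cornerVertices.2 ?_, Prod.ext ?_ rfl, Prod.ext rfl ?_⟩ <;>
    · dsimp only
      omega
  · refine .inl (isInnerInterval_iff.2 ⟨h₁, h₂, fun i j hi hj hi' hj' => ?_⟩)
    rw [Finset.mem_sdiff, Finset.mem_singleton, Prod.mk.injEq]
    exact ⟨hmem i j hi hj hi' hj', by omega⟩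

theorem isInnerInterval_of_mem_cornerVertices (h : IsCorner P x y) {v : Vertex}
    (hv : v ∈ cornerVertices x y) : IsInnerInterval P (x, v.2) (v.1, y + 1) := by
  rw [mem_cornerVertices] at hv
  rw [isInnerInterval_iff]
  refine ⟨by dsimp only; omega, by dsimp only; omega, fun i j hi hj hi' hj' => ?_⟩
  have : (i = x ∧ j = y) ∨ (i = x ∧ j = y - 1) ∨ (i = x + 1 ∧ j = y) := by
    dsimp only at *
    omega
  rcases this with ⟨rfl, rfl⟩ | ⟨rfl, rfl⟩ | ⟨rfl, rfl⟩
  exacts [h.mem, h.mem_below, h.mem_right]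

theorem isInnerInterval_below (h : IsCorner P x y) :
    IsInnerInterval (P \ {(x, y)}) (x, y - 1) (x + 1, y) := by
  simp only [isInnerInterval_iff, Finset.mem_sdiff, Finset.mem_singleton]
  refine ⟨by omega, by omega, fun i j hi hj hi' hj' => ?_⟩
  obtain rfl : i = x := by omega
  obtain rfl : j = y - 1 := by omega
  exact ⟨h.mem_below, by simp⟩

theorem isInnerInterval_right (h : IsCorner P x y) :
    IsInnerInterval (P \ {(x, y)}) (x + 1, y) (x + 2, y + 1) := by
  simp only [isInnerInterval_iff, Finset.mem_sdiff, Finset.mem_singleton]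
  refine ⟨by omega, by omega, fun i j hi hj hi' hj' => ?_⟩
  obtain rfl : i = x + 1 := by omega
  obtain rfl : j = y := by omega
  exact ⟨h.mem_right, by simp⟩

theorem isInnerInterval_sdiff_cases (h : IsCorner P x y) {a b : Vertex}
    (hab : IsInnerInterval (P \ {(x, y)}) a b) :
    IsInnerInterval (P \ {(x, y), (x, y - 1), (x + 1, y)}) a b ∨
      (a.1 ≤ x ∧ a.2 = y - 1 ∧ b = (x + 1, y)) ∨
      (a = (x + 1, y) ∧ b.1 = x + 2 ∧ y + 1 ≤ b.2) := by
  obtain ⟨h₁, h₂, hmem⟩ := isInnerInterval_iff.1 hab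
  have := hab.not_le_of_notMem (i := x) (j := y) (by simp)
  have := hab.not_le_of_notMem fun hC => h.below_right (Finset.sdiff_subset hC)
  have := hab.not_le_of_notMem fun hC => h.below_below (Finset.sdiff_subset hC)
  have := hab.not_le_of_notMem fun hC => h.right_right (Finset.sdiff_subset hC)
  rw [or_iff_not_imp_right, isInnerInterval_iff]
  simp only [Prod.ext_iff]
  refine fun hstrip => ⟨h₁, h₂, fun i j hi hj hi' hj' => ?_⟩
  have := (Finset.mem_sdiff.1 (hmem i j hi hj hi' hj')).1
  simp only [Finset.mem_sdiff, Finset.mem_insert, Finset.mem_singleton, Prod.mk.injEq]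
  exact ⟨this, by omega⟩

end IsCorner

section CornerRelations

variable {K : Type*} [Field K] {P : Finset Cell} {x y : ℤ}

/-- The product of the diagonal values of `f` on the interval with anti-diagonal corners
`(x, y + 1)` and `v`. -/
def cornerProduct {S : Type*} [Mul S] (f : Vertex → S) (x y : ℤ) (v : Vertex) : S :=
  f (x, v.2) * f (v.1, y + 1)

theorem RespectsMinors.mul_eq_of_isInnerInterval {S : Type*} [CommMagma S] {f : Vertex → S}
    (hf : RespectsMinors P f) {a b : Vertex} (hab : IsInnerInterval P a b) {i j k l : ℤ}
    (hi : a.1 ≤ i) (hik : i ≤ k) (hk : k ≤ b.1) (hj : a.2 ≤ j) (hjl : j ≤ l) (hl : l ≤ b.2) :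
    f (i, j) * f (k, l) = f (i, l) * f (k, j) := by
  rcases hik.eq_or_lt with rfl | hik
  · exact mul_comm _ _
  rcases hjl.eq_or_lt with rfl | hjl
  · rfl
  refine hf (i, j) (k, l) (isInnerInterval_iff.2 ⟨hik, hjl, fun c d hc hd hc' hd' => ?_⟩)
  dsimp only at *
  exact (isInnerInterval_iff.1 hab).2.2 c d (by omega) (by omega) (by omega) (by omega)

theorem RespectsMinors.mul_cornerProduct {S : Type*} [CommRing S] {f : Vertex → S}
    (hf : RespectsMinors (P \ {(x, y)}) f) (h : IsCorner P x y) {v w : Vertex}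
    (hv : v ∈ cornerVertices x y) (hw : w ∈ cornerVertices x y) :
    f v * cornerProduct f x y w = cornerProduct f x y v * f w := by
  have hbelow := hf _ _ h.isInnerInterval_below
  have hright := hf _ _ h.isInnerInterval_right
  simp only [cornerVertices, Finset.mem_insert, Finset.mem_singleton] at hv hw
  dsimp only at hbelow hright
  rcases hv with rfl | rfl | rfl <;> rcases hw with rfl | rfl | rfl <;> dsimp only [cornerProduct]
  · ring
  · linear_combination f (x + 1, y + 1) * hbelow
  · linear_combination f (x, y) * hright
  · linear_combination -f (x + 1, y + 1) * hbelow
  · ring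
  · linear_combination f (x, y - 1) * hright - f (x + 2, y + 1) * hbelow
  · linear_combination -f (x, y) * hright
  · linear_combination f (x + 2, y + 1) * hbelow - f (x, y - 1) * hright
  · ring

namespace IsCorner

open MvPolynomial CoordinateRing

theorem mem_vertexSet_of_mem_cornerVertices (h : IsCorner P x y) {v : Vertex}
    (hv : v ∈ cornerVertices x y) :
    v ∈ vertexSet (P \ {(x, y)}) ∧ (x, v.2) ∈ vertexSet (P \ {(x, y)}) ∧
      (v.1, y + 1) ∈ vertexSet (P \ {(x, y)}) := by
  have hbelow {w : Vertex} := h.isInnerInterval_below.mem_vertexSet (v := w)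
  have hright {w : Vertex} := h.isInnerInterval_right.mem_vertexSet (v := w)
  simp only [cornerVertices, Finset.mem_insert, Finset.mem_singleton] at hv
  rcases hv with rfl | rfl | rfl
  · exact ⟨hbelow (by simp) (by simp), hbelow (by simp) (by simp), hright (by simp) (by simp)⟩
  · exact ⟨hbelow (by simp) (by simp), hbelow (by simp) (by simp), hright (by simp) (by simp)⟩
  · exact ⟨hright (by simp) (by simp), hbelow (by simp) (by simp), hright (by simp) (by simp)⟩

theorem killVariables_X (h : IsCorner P x y) {v : Vertex}
    (hv : v ∈ vertexSet (P \ {(x, y), (x, y - 1), (x + 1, y)})) :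
    killVariables (cornerVertices x y : Set Vertex) (X v : MvPolynomial Vertex K) = X v :=
  killVariables_X_of_notMem fun hvT => h.notMem_vertexSet_of_mem_cornerVertices hvT hv

theorem exists_minor_below_mem_substitutionGraph {a : Vertex} (ha : a.1 ≤ x)
    (ha₂ : a.2 = y - 1) (hab : IsInnerInterval (P \ {(x, y)}) a (x + 1, y)) :
    ∃ z ∈ Ideal.span (relations K (P \ {(x, y)})),
      (X a * X (x + 1, y) - X (a.1, y) * X (x + 1, a.2), z) ∈
        substitutionGraph (cornerVertices x y : Set Vertex) (cornerProduct X x y) := by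
  obtain ⟨i, j⟩ := a
  obtain rfl : j = y - 1 := ha₂
  refine ⟨X (i, y - 1) * cornerProduct X x y (x + 1, y) -
    X (i, y) * cornerProduct X x y (x + 1, y - 1), ?_, ?_⟩
  · have hminor := (respectsMinors_var (K := K)).mul_eq_of_isInnerInterval hab
      (i := i) (k := x) (j := y - 1) (l := y) le_rfl ha (by simp) le_rfl (by simp) le_rfl
    rw [← ker_aeval_var, RingHom.mem_ker]
    simp only [map_sub, map_mul, aeval_X, cornerProduct]
    linear_combination var K (P \ {(x, y)}) (x + 1, y + 1) * hminor
  · exact mul_X_sub_mul_X_prodMk_mem_substitutionGraph (by simp [cornerVertices])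
      (by simp [cornerVertices]) _ _

theorem exists_minor_right_mem_substitutionGraph {b : Vertex}
    (hb₁ : b.1 = x + 2) (hb : y + 1 ≤ b.2) (hab : IsInnerInterval (P \ {(x, y)}) (x + 1, y) b) :
    ∃ z ∈ Ideal.span (relations K (P \ {(x, y)})),
      (X (x + 1, y) * X b - X (x + 1, b.2) * X (b.1, y), z) ∈
        substitutionGraph (cornerVertices x y : Set Vertex) (cornerProduct X x y) := by
  obtain ⟨k, j⟩ := b
  obtain rfl : k = x + 2 := hb₁
  refine ⟨X (x + 2, j) * cornerProduct X x y (x + 1, y) -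
    X (x + 1, j) * cornerProduct X x y (x + 2, y), ?_, ?_⟩
  · have hminor := (respectsMinors_var (K := K)).mul_eq_of_isInnerInterval hab
      (i := x + 1) (k := x + 2) (j := y + 1) (l := j) le_rfl (by simp) le_rfl (by simp) hb le_rfl
    rw [← ker_aeval_var, RingHom.mem_ker]
    simp only [map_sub, map_mul, aeval_X, cornerProduct]
    linear_combination var K (P \ {(x, y)}) (x, y) * hminor
  · rw [mul_comm (X (x + 1, y))]
    exact mul_X_sub_mul_X_prodMk_mem_substitutionGraph (by simp [cornerVertices])
      (by simp [cornerVertices]) _ _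

theorem killVariables_eq_or_exists_mem_substitutionGraph (h : IsCorner P x y)
    {g : MvPolynomial Vertex K} (hg : g ∈ relations K (P \ {(x, y)})) :
    killVariables (cornerVertices x y : Set Vertex) g = g ∨
      ∃ z ∈ Ideal.span (relations K (P \ {(x, y)})),
        (g, z) ∈ substitutionGraph (cornerVertices x y : Set Vertex) (cornerProduct X x y) := by
  obtain (⟨a, b, hab, rfl⟩ | ⟨v, hv, rfl⟩) := hg
  · rcases h.isInnerInterval_sdiff_cases hab with hQ₁ | ⟨ha, ha₂, rfl⟩ | ⟨rfl, hb₁, hb⟩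
    · have hX (v : Vertex) (h₁ : v.1 = a.1 ∨ v.1 = b.1) (h₂ : v.2 = a.2 ∨ v.2 = b.2) :=
        h.killVariables_X (K := K) (hQ₁.mem_vertexSet h₁ h₂)
      left
      rw [map_sub, map_mul, map_mul, hX a (by simp) (by simp), hX b (by simp) (by simp),
        hX (a.1, b.2) (by simp) (by simp), hX (b.1, a.2) (by simp) (by simp)]
    · exact .inr (exists_minor_below_mem_substitutionGraph ha ha₂ hab)
    · exact .inr (exists_minor_right_mem_substitutionGraph hb₁ hb hab)
  · exact .inl (killVariables_X_of_notMem fun hvT =>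
      hv (h.mem_vertexSet_of_mem_cornerVertices hvT).1)

theorem sum_mul_cornerProduct_eq_zero (h : IsCorner P x y)
    {a : cornerVertices x y → CoordinateRing K (P \ {(x, y)})}
    (ha : ∑ v, a v * var K (P \ {(x, y)}) v = 0) :
    ∑ v, a v * cornerProduct (var K (P \ {(x, y)})) x y v = 0 := by
  have hsurj (v : cornerVertices x y) : ∃ f, aeval (var K (P \ {(x, y)})) f = a v :=
    aeval_var_surjective (a v)
  choose A hA using hsurj
  have hker (f : MvPolynomial Vertex K) :
      f ∈ Ideal.span (relations K (P \ {(x, y)})) ↔ aeval (var K (P \ {(x, y)})) f = 0 := by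
    rw [← ker_aeval_var, RingHom.mem_ker]
  have hproduct (v : Vertex) : aeval (R := K) (var K (P \ {(x, y)})) (cornerProduct X x y v) =
      cornerProduct (var K (P \ {(x, y)})) x y v := by simp [cornerProduct]
  have hsum : ∑ v, A v * cornerProduct X x y v ∈ Ideal.span (relations K (P \ {(x, y)})) := by
    refine sum_mul_mem_of_sum_mul_X_mem (s := cornerVertices x y) (fun v hv w hw => ?_)
      (fun g => h.killVariables_eq_or_exists_mem_substitutionGraph) ?_
    · rw [hker, map_sub, map_mul, map_mul, aeval_X, aeval_X, hproduct, hproduct, sub_eq_zero]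
      exact respectsMinors_var.mul_cornerProduct h hv hw
    · simpa [hker, hA] using ha
  simpa [hker, hA, hproduct] using hsum

end IsCorner

end CornerRelations

section AdjoinCornerVertex

open Polynomial CoordinateRing

-- Without this shortcut, instance search does not find `CommRing (CoordinateRing K P)[X]`.
noncomputable local instance {K : Type*} [Field K] {P : Finset Cell} :
    CommRing (CoordinateRing K P) :=
  Ideal.Quotient.commRing _

variable {K : Type*} [Field K] {P : Finset Cell} {x y : ℤ}

namespace CoordinateRing

variable {Q : Finset Cell}

variable (K) in
/-- The map `K[Q] → K[P]` induced by an inclusion `Q ⊆ P`. -/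
noncomputable def inclusion (hQP : Q ⊆ P) : CoordinateRing K Q →ₐ[K] CoordinateRing K P :=
  lift (var K P) (respectsMinors_var.mono hQP)

theorem inclusion_var (hQP : Q ⊆ P) {v : Vertex} (hv : v ∈ vertexSet Q) :
    inclusion K hQP (var K Q v) = var K P v :=
  lift_var hv

variable (K) in
/-- The map `K[Q][X] → K[P]` that extends `K[Q] → K[P]` by `X ↦ x_w`. -/
noncomputable def evalVar (hQP : Q ⊆ P) (w : Vertex) :
    (CoordinateRing K Q)[X] →ₐ[K] CoordinateRing K P :=
  eval₂AlgHom (inclusion K hQP) (var K P w) fun _ => Commute.all _ _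

theorem evalVar_C (hQP : Q ⊆ P) (w : Vertex) (f : CoordinateRing K Q) :
    evalVar K hQP w (C f) = inclusion K hQP f := by
  simp [evalVar]

theorem evalVar_X (hQP : Q ⊆ P) (w : Vertex) : evalVar K hQP w X = var K P w := by
  simp [evalVar]

theorem evalVar_surjective (hQP : Q ⊆ P) {w : Vertex}
    (hP : vertexSet P = insert w (vertexSet Q)) : Function.Surjective (evalVar K hQP w) := by
  refine surjective_of_var_mem_range (f := evalVar K hQP w) fun v hv => ?_
  rw [hP, Finset.mem_insert] at hv
  rcases hv with rfl | hv
  · exact ⟨X, evalVar_X hQP v⟩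
  · exact ⟨C (var K Q v), (evalVar_C hQP w _).trans (inclusion_var hQP hv)⟩

end CoordinateRing

variable (K P x y) in
/-- The ideal of `K[P \ {(x, y)}][X]` generated by the minors of `P` that involve the variable
`x_{(x, y + 1)}`, for which `X` stands. -/
noncomputable def cornerIdeal : Ideal (CoordinateRing K (P \ {(x, y)}))[X] :=
  Ideal.span (Set.range fun v : cornerVertices x y =>
    X * C (var K (P \ {(x, y)}) v) - C (cornerProduct (var K (P \ {(x, y)})) x y v))

namespace IsCorner

theorem inclusion_cornerProduct (h : IsCorner P x y) {v : Vertex} (hv : v ∈ cornerVertices x y) :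
    inclusion K Finset.sdiff_subset (cornerProduct (var K (P \ {(x, y)})) x y v) =
      var K P (x, y + 1) * var K P v := by
  obtain ⟨-, hdiag, hdiag'⟩ := h.mem_vertexSet_of_mem_cornerVertices hv
  rw [cornerProduct, map_mul, inclusion_var _ hdiag, inclusion_var _ hdiag']
  exact respectsMinors_var _ _ (h.isInnerInterval_of_mem_cornerVertices hv)

theorem respectsMinors_mk_cornerIdeal (h : IsCorner P x y) :
    RespectsMinors P fun v => Ideal.Quotient.mk (cornerIdeal K P x y)
      (if v = (x, y + 1) then X else C (var K (P \ {(x, y)}) v)) := by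
  intro a b hab
  dsimp only
  rw [← map_mul, ← map_mul]
  rcases h.isInnerInterval_cases hab with hQ | ⟨v, hv, rfl, rfl⟩
  · have hne (v : Vertex) (h₁ : v.1 = a.1 ∨ v.1 = b.1) (h₂ : v.2 = a.2 ∨ v.2 = b.2) :
        v ≠ (x, y + 1) := ne_of_mem_of_not_mem (hQ.mem_vertexSet h₁ h₂) h.notMem_vertexSet
    rw [if_neg (hne a (by simp) (by simp)), if_neg (hne b (by simp) (by simp)),
      if_neg (hne (a.1, b.2) (by simp) (by simp)), if_neg (hne (b.1, a.2) (by simp) (by simp)),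
      ← C_mul, ← C_mul, respectsMinors_var a b hQ]
  · have hne {w : Vertex} (hw : w ∈ vertexSet (P \ {(x, y)})) : w ≠ (x, y + 1) :=
      ne_of_mem_of_not_mem hw h.notMem_vertexSet
    obtain ⟨hmem, hdiag, hdiag'⟩ := h.mem_vertexSet_of_mem_cornerVertices hv
    rw [if_neg (hne hdiag), if_neg (hne hdiag'), if_pos rfl, if_neg (hne hmem), ← C_mul]
    have hrel : X * C (var K (P \ {(x, y)}) v) - C (cornerProduct (var K (P \ {(x, y)})) x y v) ∈
        cornerIdeal K P x y := Ideal.subset_span ⟨⟨v, hv⟩, rfl⟩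
    exact (Ideal.Quotient.eq.2 hrel).symm

theorem ker_evalVar (h : IsCorner P x y) :
    RingHom.ker (evalVar K (Finset.sdiff_subset (s := P) (t := {(x, y)})) (x, y + 1)) =
      cornerIdeal K P x y := by
  apply le_antisymm
  · have hmem {v : Vertex} (hv : v ∈ insert (x, y + 1) (vertexSet (P \ {(x, y)}))) :
        v ∈ vertexSet P := h.vertexSet_eq ▸ hv
    let φ := lift (K := K) (S := _ ⧸ cornerIdeal K P x y) _ h.respectsMinors_mk_cornerIdeal
    refine ker_le_of_comp_eq_mk φ
      (Polynomial.algHom_ext' (CoordinateRing.algHom_ext fun v hv => ?_) ?_)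
    · change φ (evalVar K _ _ (C (var K _ v))) = Ideal.Quotient.mk _ (C (var K _ v))
      rw [evalVar_C, inclusion_var _ hv, lift_var (hmem (Finset.mem_insert_of_mem hv)),
        if_neg (ne_of_mem_of_not_mem hv h.notMem_vertexSet)]
    · rw [AlgHom.comp_apply, evalVar_X, lift_var (hmem (Finset.mem_insert_self _ _)), if_pos rfl]
      rfl
  · rw [cornerIdeal, Ideal.span_le]
    rintro _ ⟨v, rfl⟩
    have hmem := (h.mem_vertexSet_of_mem_cornerVertices v.2).1
    simp only [SetLike.mem_coe, RingHom.mem_ker, map_sub, map_mul, evalVar_X, evalVar_C,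
      inclusion_var _ hmem, h.inclusion_cornerProduct v.2, sub_self]

theorem inclusion_injective (h : IsCorner P x y) :
    Function.Injective (inclusion K (Finset.sdiff_subset (s := P) (t := {(x, y)}))) := by
  rw [injective_iff_map_eq_zero]
  intro f hf
  rw [← evalVar_C _ (x, y + 1), ← RingHom.mem_ker, h.ker_evalVar] at hf
  exact eq_zero_of_C_mem_span_X_mul_C_sub_C (fun _ => h.sum_mul_cornerProduct_eq_zero) hf

variable (K) in
/-- The projection `K[P \ {(x, y)}] → K[P \ {(x, y), (x, y - 1), (x + 1, y)}]` that kills the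
variables of the corner vertices. -/
noncomputable def projection (h : IsCorner P x y) : CoordinateRing K (P \ {(x, y)}) →ₐ[K]
    CoordinateRing K (P \ {(x, y), (x, y - 1), (x + 1, y)}) :=
  lift (var K _) fun a b hab => by
    have hT {v : Vertex} (hv : v ∈ cornerVertices x y) := var_of_notMem (K := K)
      (h.notMem_vertexSet_of_mem_cornerVertices hv)
    rcases h.isInnerInterval_sdiff_cases hab with hQ₁ | ⟨-, ha, rfl⟩ | ⟨rfl, hb, -⟩
    · exact respectsMinors_var a b hQ₁
    · rw [hT (v := (x + 1, y)) (by simp [cornerVertices]),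
        hT (v := ((x + 1, y).1, a.2)) (by simp [cornerVertices, ha]), mul_zero, mul_zero]
    · rw [hT (v := (x + 1, y)) (by simp [cornerVertices]),
        hT (v := (b.1, (x + 1, y).2)) (by simp [cornerVertices, hb]), zero_mul, mul_zero]

theorem projection_var (h : IsCorner P x y) {v : Vertex} (hv : v ∈ vertexSet (P \ {(x, y)})) :
    h.projection K (var K (P \ {(x, y)}) v) =
      var K (P \ {(x, y), (x, y - 1), (x + 1, y)}) v :=
  lift_var hv

theorem ker_projection (h : IsCorner P x y) : RingHom.ker (h.projection K) =
    Ideal.span (Set.range fun v : cornerVertices x y => var K (P \ {(x, y)}) v) := by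
  set J := Ideal.span (Set.range fun v : cornerVertices x y => var K (P \ {(x, y)}) v)
  apply le_antisymm
  · have hsub : P \ {(x, y), (x, y - 1), (x + 1, y)} ⊆ P \ {(x, y)} :=
      Finset.sdiff_subset_sdiff le_rfl (by simp)
    refine ker_le_of_comp_eq_mk ((Ideal.Quotient.mkₐ K J).comp (inclusion K hsub))
      (CoordinateRing.algHom_ext fun v hv => ?_)
    rw [AlgHom.comp_apply, AlgHom.comp_apply, h.projection_var hv]
    by_cases hvT : v ∈ cornerVertices x y
    · rw [var_of_notMem (h.notMem_vertexSet_of_mem_cornerVertices hvT), map_zero, map_zero]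
      have hJ : var K (P \ {(x, y)}) v ∈ J := Ideal.subset_span ⟨⟨v, hvT⟩, rfl⟩
      exact (Ideal.Quotient.eq_zero_iff_mem.2 hJ).symm
    · rw [inclusion_var _ (h.mem_vertexSet_of_notMem_cornerVertices hv hvT)]
  · rw [Ideal.span_le]
    rintro _ ⟨v, rfl⟩
    exact (h.projection_var (h.mem_vertexSet_of_mem_cornerVertices v.2).1).trans
      (var_of_notMem (h.notMem_vertexSet_of_mem_cornerVertices v.2))

theorem mul_mem_range_inclusion_iff (h : IsCorner P x y) {f : CoordinateRing K P} :
    (∃ g : CoordinateRing K (P \ {(x, y)}),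
      inclusion K Finset.sdiff_subset g = var K P (x, y + 1) * f) ↔
      ∃ a ∈ RingHom.ker (h.projection K), inclusion K Finset.sdiff_subset a = f := by
  rw [h.ker_projection]
  constructor
  · rintro ⟨g, hg⟩
    obtain ⟨F, rfl⟩ := evalVar_surjective Finset.sdiff_subset h.vertexSet_eq f
    have hF : X * F - C g ∈ cornerIdeal K P x y := by
      rw [← h.ker_evalVar, RingHom.mem_ker, map_sub, map_mul, evalVar_X, evalVar_C, hg, sub_self]
    obtain ⟨a, ha, hFa⟩ := exists_sub_C_mem_of_X_mul_sub_C_mem hF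
    refine ⟨a, ha, ?_⟩
    change F - C a ∈ cornerIdeal K P x y at hFa
    rw [← h.ker_evalVar, RingHom.mem_ker, map_sub, evalVar_C, sub_eq_zero] at hFa
    exact hFa.symm
  · rintro ⟨a, ha, rfl⟩
    obtain ⟨c, rfl⟩ := Ideal.mem_span_range_iff_exists_fun.1 ha
    refine ⟨∑ v, c v * cornerProduct (var K (P \ {(x, y)})) x y v, ?_⟩
    rw [map_sum, map_sum, Finset.mul_sum]
    refine Finset.sum_congr rfl fun v _ => ?_
    rw [map_mul, map_mul, h.inclusion_cornerProduct v.2,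
      inclusion_var _ (h.mem_vertexSet_of_mem_cornerVertices v.2).1, mul_left_comm]

end IsCorner

end AdjoinCornerVertex

section HilbertFunction

open CoordinateRing

variable {K : Type*} [Field K] {P Q : Finset Cell} {x y : ℤ}

namespace CoordinateRing

theorem scale_inclusion (hQP : Q ⊆ P) (f : CoordinateRing K Q) :
    scale K P (inclusion K hQP f) = Polynomial.mapAlgHom (inclusion K hQP) (scale K Q f) := by
  have hcomp : (scale K P).comp (inclusion K hQP) =
      (Polynomial.mapAlgHom (inclusion K hQP)).comp (scale K Q) :=
    algHom_ext fun v hv => by simp [inclusion_var hQP hv, scale_var]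
  exact DFunLike.congr_fun hcomp f

theorem inclusion_mem_gradedPiece_iff {hQP : Q ⊆ P}
    (hinj : Function.Injective (inclusion K hQP)) {n : ℕ} {f : CoordinateRing K Q} :
    inclusion K hQP f ∈ gradedPiece K P n ↔ f ∈ gradedPiece K Q n := by
  rw [mem_gradedPiece_iff, mem_gradedPiece_iff, scale_inclusion,
    ← (Polynomial.map_injective (inclusion K hQP).toRingHom hinj).eq_iff]
  simp

theorem map_inclusion_gradedPiece (hQP : Q ⊆ P) (n : ℕ) :
    (gradedPiece K Q n).map (inclusion K hQP).toLinearMap =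
      Submodule.span K (var K P '' vertexSet Q) ^ n := by
  rw [gradedPiece_eq_pow, Submodule.map_pow, Submodule.map_span, Set.image_image]
  exact congrArg (Submodule.span K · ^ n)
    (Set.image_congr fun v hv => inclusion_var hQP (Finset.mem_coe.1 hv))

theorem gradedPiece_succ_eq_sup (hQP : Q ⊆ P) {w : Vertex}
    (hP : vertexSet P = insert w (vertexSet Q)) (n : ℕ) : gradedPiece K P (n + 1) =
      (gradedPiece K Q (n + 1)).map (inclusion K hQP).toLinearMap ⊔
        (gradedPiece K P n).map (LinearMap.mulLeft K (var K P w)) := by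
  have himage : var K P '' vertexSet P = insert (var K P w) (var K P '' vertexSet Q) := by
    rw [← Set.image_insert_eq, ← Finset.coe_insert]
    exact congrArg (fun s : Finset Vertex => var K P '' s) hP
  rw [map_inclusion_gradedPiece, gradedPiece_eq_pow, gradedPiece_eq_pow, himage]
  exact span_insert_pow_succ _ _ n

end CoordinateRing

namespace IsCorner

theorem map_projection_gradedPiece (h : IsCorner P x y) (n : ℕ) :
    (gradedPiece K (P \ {(x, y)}) n).map (h.projection K).toLinearMap =
      gradedPiece K (P \ {(x, y), (x, y - 1), (x + 1, y)}) n := by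
  have hsub : vertexSet (P \ {(x, y), (x, y - 1), (x + 1, y)}) ⊆ vertexSet (P \ {(x, y)}) :=
    Finset.biUnion_subset_biUnion_of_subset_left _ (Finset.sdiff_subset_sdiff le_rfl (by simp))
  rw [gradedPiece_eq_pow, gradedPiece_eq_pow, Submodule.map_pow, Submodule.map_span]
  congr 1
  apply le_antisymm
  · rw [Submodule.span_le]
    rintro _ ⟨_, ⟨v, hv, rfl⟩, rfl⟩
    rw [AlgHom.toLinearMap_apply, h.projection_var hv]
    by_cases hv₁ : v ∈ vertexSet (P \ {(x, y), (x, y - 1), (x + 1, y)})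
    · exact Submodule.subset_span ⟨v, hv₁, rfl⟩
    · rw [var_of_notMem hv₁]
      exact zero_mem _
  · refine Submodule.span_mono ?_
    rintro _ ⟨v, hv, rfl⟩
    exact ⟨_, ⟨v, hsub hv, rfl⟩, h.projection_var (hsub hv)⟩

theorem gradedPiece_inf_comap_mulLeft (h : IsCorner P x y) (n : ℕ) :
    gradedPiece K P n ⊓
        ((gradedPiece K (P \ {(x, y)}) (n + 1)).map
          (inclusion K Finset.sdiff_subset).toLinearMap).comap
            (LinearMap.mulLeft K (var K P (x, y + 1))) =
      (gradedPiece K (P \ {(x, y)}) n ⊓ LinearMap.ker (h.projection K).toLinearMap).map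
        (inclusion K (Finset.sdiff_subset (s := P))).toLinearMap := by
  have hmem (n : ℕ) (f : CoordinateRing K (P \ {(x, y)})) :=
    inclusion_mem_gradedPiece_iff h.inclusion_injective (n := n) (f := f)
  have hu : var K P (x, y + 1) ∈ gradedPiece K P 1 := by
    rw [gradedPiece_eq_pow, Submodule.pow_one]
    exact Submodule.subset_span ⟨_, by simp [h.vertexSet_eq], rfl⟩
  ext f
  simp only [Submodule.mem_inf, Submodule.mem_comap, Submodule.mem_map, LinearMap.mulLeft_apply,
    LinearMap.mem_ker, AlgHom.toLinearMap_apply]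
  constructor
  · rintro ⟨hf, g, -, hg⟩
    obtain ⟨a, ha, rfl⟩ := h.mul_mem_range_inclusion_iff.1 ⟨g, hg⟩
    exact ⟨a, ⟨(hmem n a).1 hf, ha⟩, rfl⟩
  · rintro ⟨a, ⟨ha, ha'⟩, rfl⟩
    obtain ⟨g, hg⟩ := h.mul_mem_range_inclusion_iff.2 ⟨a, ha', rfl⟩
    refine ⟨(hmem n a).2 ha, g, (hmem (n + 1) g).1 ?_, hg⟩
    have hua := Submodule.mul_mem_mul hu ((hmem n a).2 ha)
    rwa [← hg, gradedPiece_eq_pow, gradedPiece_eq_pow, ← pow_add, add_comm, ← gradedPiece_eq_pow]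
      at hua

theorem finrank_map_inclusion (h : IsCorner P x y)
    (A : Submodule K (CoordinateRing K (P \ {(x, y)}))) :
    Module.finrank K (A.map (inclusion K (Finset.sdiff_subset (s := P))).toLinearMap) =
      Module.finrank K A :=
  (LinearEquiv.finrank_eq (Submodule.equivMapOfInjective _ h.inclusion_injective A)).symm

theorem hilbertFunction_zero (h : IsCorner P x y) :
    hilbertFunction K P 0 = hilbertFunction K (P \ {(x, y)}) 0 := by
  rw [hilbertFunction, hilbertFunction, ← h.finrank_map_inclusion, map_inclusion_gradedPiece,
    gradedPiece_eq_pow, Submodule.pow_zero, Submodule.pow_zero]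

theorem hilbertFunction_succ_add (h : IsCorner P x y) (n : ℕ) :
    hilbertFunction K P (n + 1) + hilbertFunction K (P \ {(x, y)}) n =
      hilbertFunction K P n + hilbertFunction K (P \ {(x, y)}) (n + 1) +
        hilbertFunction K (P \ {(x, y), (x, y - 1), (x + 1, y)}) n := by
  have hP := finrank_sup_map_add_finrank_inf_comap (LinearMap.mulLeft K (var K P (x, y + 1)))
    (gradedPiece K P n)
    ((gradedPiece K (P \ {(x, y)}) (n + 1)).map (inclusion K Finset.sdiff_subset).toLinearMap)
  have hQ := finrank_map_add_finrank_inf_ker (h.projection K).toLinearMap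
    (gradedPiece K (P \ {(x, y)}) n)
  rw [← gradedPiece_succ_eq_sup _ h.vertexSet_eq, h.gradedPiece_inf_comap_mulLeft,
    h.finrank_map_inclusion, h.finrank_map_inclusion] at hP
  rw [h.map_projection_gradedPiece] at hQ
  simp only [hilbertFunction]
  omega

end IsCorner

end HilbertFunction

end Polyomino

theorem mainTheorem9_general {K : Type*} [Field K] {P : Finset Polyomino.Cell} {x y : ℤ}
    (h : Polyomino.IsCorner P x y) :
    Polyomino.hilbertSeries K P =
      Polyomino.hilbertSeries K (P \ {(x, y)}) +
        (PowerSeries.X * (1 - PowerSeries.X)⁻¹) *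
          Polyomino.hilbertSeries K (P \ {(x, y), (x, y - 1), (x + 1, y)}) := by
  apply Polyomino.eq_add_X_mul_inv_one_sub_X_mul
  · simp only [Polyomino.hilbertSeries, PowerSeries.coeff_mk]
    exact_mod_cast h.hilbertFunction_zero
  · intro n
    simp only [Polyomino.hilbertSeries, PowerSeries.coeff_mk]
    exact_mod_cast h.hilbertFunction_succ_add n

theorem mainTheorem9 {K : Type*} [Field K] (P : Finset Polyomino.Cell)
    (hP : Polyomino.IsClosedPath P) (A As A₁ B₁ Br : Polyomino.Cell)
    (hW : Polyomino.IsConfigurationW P A As A₁ B₁ Br) :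
    Polyomino.hilbertSeries K P =
      Polyomino.hilbertSeries K (P \ {A}) +
        (PowerSeries.X * (1 - PowerSeries.X)⁻¹) *
          Polyomino.hilbertSeries K (P \ {A, A₁, B₁}) := by
  obtain ⟨hA, rfl, rfl⟩ := hW.isCorner hP
  exact mainTheorem9_general hA
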